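/- Let $(\Omega,\mathcal F)$ be a measurable space, $T:\Omega\to\Omega$ a measurable map, and $\mathcal I=\{A\in\mathcal F: T^{-1}A=A\}$. A capacity is a monotone set function $V:\mathcal F\to[0,1]$ with $V(\emptyset)=0$ and $V(\Omega)=1$. It is an upper probability if there is a set $\Lambda$ of ($\sigma$-additive) probabilities on $\mathcal F$, compact in the weak* topology (the topology of convergence $P_\alpha(A)\to P(A)$ for every $A\in\mathcal F$), such that $V(A)=\max_{P\in\Lambda}P(A)$ for all $A\in\mathcal F$. It is $T$-invariant if $V(T^{-1}A)=V(A)$ for all $A\in\mathcal F$. A $T$-invariant capacity $V$ is ergodic if for every $A\in\mathcal I$ one has $V(A)\in\{0,1\}$, and $V(A)=0$ or $V(\Omega\setminus A)=0$. The core of $V$, $\operatorname{core}(V)$, is the set of finitely additive capacities $P$ with $P(A)\le V(A)$ for all $A\in\mathcal F$. Let $\mathcal M^e(T)$ be the set of $T$-invariant probabilities $Q$ on $\mathcal F$ with $Q(A)\in\{0,1\}$ for all $A\in\mathcal I$. A property holds $V$-almost surely if it holds on some $A\in\mathcal F$ with $V(\Omega\setminus A)=0$. **Theorem.** Let $V$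 be a $T$-invariant upper probability on $(\Omega,\mathcal F)$. Then $V$ is ergodic with respect to $T$ if and only if there exists a unique $Q\in\mathcal M^e(T)\cap\operatorname{core}(V)$ such that for every $\mathcal F$-measurable $f:\Omega\to\mathbb R$ with $\int|f|\,dQ<\infty$, $$\lim_{n\to\infty}\frac1n\sum_{i=0}^{n-1}f(T^i\omega)=\int f\,dQ\qquad\text{for $V$-almost every }\omega\in\Omega.$$ -/

import Mathlib

open MeasureTheory Filter Topology

/-- A capacity on a measurable space: a monotone set function, defined on the measurable sets,
with value `0` at the empty set and `1` at the whole space (so its values lie in `[0, 1]`). -/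
structure Capacity (Ω : Type*) [MeasurableSpace Ω] where
  toFun : Subtype (MeasurableSet : Set Ω → Prop) → ℝ
  map_empty : toFun ∅ = 0
  map_univ : toFun ⟨Set.univ, MeasurableSet.univ⟩ = 1
  mono : ∀ A B : Subtype (MeasurableSet : Set Ω → Prop), (A : Set Ω) ⊆ B → toFun A ≤ toFun B

namespace Capacity

variable {Ω : Type*} [MeasurableSpace Ω]

instance : CoeFun (Capacity Ω) fun _ => Subtype (MeasurableSet : Set Ω → Prop) → ℝ := ⟨toFun⟩

/-- The weak* topology: `P_α → P` if and only if `P_α A → P A` for every measurable set `A`. -/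
instance : TopologicalSpace (Capacity Ω) := TopologicalSpace.induced toFun inferInstance

/-- A (countably additive) probability, seen as a capacity. -/
noncomputable def ofProbability (P : ProbabilityMeasure Ω) : Capacity Ω where
  toFun A := (P : Measure Ω).real A
  map_empty := by simp
  map_univ := by simp
  mono A B h := measureReal_mono h

/-- Finitely additive capacities. -/
def IsAdditive (μ : Capacity Ω) : Prop :=
  ∀ A B : Subtype (MeasurableSet : Set Ω → Prop), Disjoint (A : Set Ω) B →
    μ (A ∪ B) = μ A + μ B

/-- The core of a capacity: the additive capacities that it dominates setwise. -/
def core (μ : Capacity Ω) : Set (Capacity Ω) :=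
  {P | P.IsAdditive ∧ ∀ A, P A ≤ μ A}

/-- `V` is an upper probability if `V A = max {P A | P ∈ Λ}` for all measurable `A`, for some
weak* compact set `Λ` of (countably additive) probabilities. -/
def IsUpperProbability (V : Capacity Ω) : Prop :=
  ∃ Λ : Set (ProbabilityMeasure Ω), IsCompact (ofProbability '' Λ) ∧
    ∀ A, IsGreatest ((fun P => ofProbability P A) '' Λ) (V A)

/-- `μ (T⁻¹ A) = μ A` for every measurable `A`. -/
def IsInvariant (μ : Capacity Ω) {T : Ω → Ω} (hT : Measurable T) : Prop :=
  ∀ A : Subtype (MeasurableSet : Set Ω → Prop), μ ⟨T ⁻¹' A, hT A.2⟩ = μ A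

/-- An invariant capacity is ergodic if every measurable `A` with `T⁻¹ A = A` satisfies
`μ A ∈ {0, 1}`, and `μ A = 0` or `μ Aᶜ = 0`. -/
def IsErgodic (μ : Capacity Ω) {T : Ω → Ω} (hT : Measurable T) : Prop :=
  μ.IsInvariant hT ∧
    ∀ A : Subtype (MeasurableSet : Set Ω → Prop), T ⁻¹' (A : Set Ω) = A →
      (μ A = 0 ∨ μ A = 1) ∧ (μ A = 0 ∨ μ Aᶜ = 0)

/-- `p` holds `μ`-almost surely: it holds on a measurable set `A` with `μ Aᶜ = 0`. -/
def AlmostSurely (μ : Capacity Ω) (p : Ω → Prop) : Prop :=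
  ∃ A : Subtype (MeasurableSet : Set Ω → Prop), μ Aᶜ = 0 ∧ ∀ ω ∈ (A : Set Ω), p ω

end Capacity

/-! Compactness of `Λ` makes `V` continuous from above at `∅`, by a Dini argument, so every element
of the core is countably additive. Cesàro means of the translates of one dominated probability stay
below the invariant `V`; an ultrafilter limit of them is an invariant `Q` in the core.

If `V` is ergodic, each invariant set or its complement is `V`-null, hence `Q`-null, so `Q` is
ergodic. By Birkhoff's theorem the convergence set of `f` has `Q`-measure one. It is strictly
invariant and not `V`-null, so its complement is `V`-null. The limits determine `Q`: by
subadditivity two `V`-almost sure events share a point, and there the time averages of an indicator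
have only one limit.

Conversely, the indicator of an invariant set `A` equals its own time averages, so off a `V`-null
set it is the constant `Q A`, which is `0` or `1`. -/

namespace MeasureTheory

/-! ### Maximal and pointwise ergodic theorems for a probability measure -/

variable {α : Type*} {T : α → α} {f : α → ℝ}

/-- The maximum of the first `n + 1` nontrivial Birkhoff sums of `f`, defined by recursion. -/
noncomputable def birkhoffMax (T : α → α) (f : α → ℝ) : ℕ → α → ℝ
  | 0 => f
  | n + 1 => fun x => f x + max 0 (birkhoffMax T f n (T x))

theorem birkhoffMax_succ (n : ℕ) (x : α) :
    birkhoffMax T f (n + 1) x = f x + max 0 (birkhoffMax T f n (T x)) := rfl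

theorem birkhoffSum_le_birkhoffMax (n : ℕ) (x : α) :
    birkhoffSum T f (n + 1) x ≤ birkhoffMax T f n x := by
  induction n generalizing x with
  | zero => simp [birkhoffMax]
  | succ n ih =>
    rw [birkhoffSum_succ', birkhoffMax_succ]
    gcongr
    exact (ih _).trans (le_max_right _ _)

theorem birkhoffMax_le_succ (n : ℕ) (x : α) :
    birkhoffMax T f n x ≤ birkhoffMax T f (n + 1) x := by
  induction n generalizing x with
  | zero => simp [birkhoffMax]
  | succ n ih =>
    rw [birkhoffMax_succ, birkhoffMax_succ (n + 1)]
    gcongr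
    exact ih _

theorem monotone_birkhoffMax (x : α) : Monotone fun n => birkhoffMax T f n x :=
  monotone_nat_of_le_succ fun n => birkhoffMax_le_succ n x

/-- By the recursion, passing from `T x` to `x` changes the bound only by the finite amount `f x`
and a truncation at `0`. The set of unbounded maxima is therefore exactly invariant. -/
theorem bddAbove_birkhoffMax_comp_iff (x : α) :
    BddAbove (Set.range fun n => birkhoffMax T f n (T x)) ↔
      BddAbove (Set.range fun n => birkhoffMax T f n x) := by
  constructor
  · rintro ⟨C, hC⟩
    refine ⟨f x + max 0 C, ?_⟩
    rintro _ ⟨n, rfl⟩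
    refine (birkhoffMax_le_succ n x).trans ?_
    rw [birkhoffMax_succ]
    gcongr
    exact hC ⟨n, rfl⟩
  · rintro ⟨C, hC⟩
    refine ⟨C - f x, ?_⟩
    rintro _ ⟨n, rfl⟩
    have h := hC ⟨n + 1, rfl⟩
    simp only [birkhoffMax_succ] at h
    have := le_max_right 0 (birkhoffMax T f n (T x))
    dsimp only
    linarith

theorem birkhoffAverage_succ_apply (n : ℕ) (x : α) :
    birkhoffAverage ℝ T f (n + 1) x =
      f x / (n + 1) + (n / (n + 1)) * birkhoffAverage ℝ T f n (T x) := by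
  rw [birkhoffAverage, birkhoffAverage, birkhoffSum_succ', smul_eq_mul, smul_eq_mul]
  rcases eq_or_ne n 0 with rfl | hn
  · simp
  · have : (n : ℝ) ≠ 0 := Nat.cast_ne_zero.2 hn
    push_cast
    field_simp

/-- This makes the convergence set satisfy `T⁻¹ A = A` on the nose, as ergodicity of a capacity
requires. -/
theorem tendsto_birkhoffAverage_apply_iff (x : α) (L : ℝ) :
    Tendsto (birkhoffAverage ℝ T f · (T x)) atTop (𝓝 L) ↔
      Tendsto (birkhoffAverage ℝ T f · x) atTop (𝓝 L) := by
  have h0 : Tendsto (fun n : ℕ => f x / ((n : ℝ) + 1)) atTop (𝓝 0) := by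
    simpa [div_eq_mul_inv] using
      (tendsto_one_div_add_atTop_nhds_zero_nat (𝕜 := ℝ)).const_mul (f x)
  have h1 : Tendsto (fun n : ℕ => (n : ℝ) / (n + 1)) atTop (𝓝 1) :=
    tendsto_natCast_div_add_atTop 1
  rw [← tendsto_add_atTop_iff_nat (f := (birkhoffAverage ℝ T f · x)) 1]
  simp only [birkhoffAverage_succ_apply]
  constructor
  · intro h
    simpa using h0.add (h1.mul h)
  · intro h
    have := (h.sub h0).div h1 one_ne_zero
    rw [sub_zero, div_one] at this
    refine this.congr' ?_
    filter_upwards [eventually_gt_atTop 0] with n hn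
    have : (0 : ℝ) < n := Nat.cast_pos.2 hn
    simp only [Pi.div_apply]
    field_simp
    ring

variable [MeasurableSpace α] {μ : Measure α}

theorem measurable_birkhoffAverage (hT : Measurable T) (hf : Measurable f) (n : ℕ) :
    Measurable (birkhoffAverage ℝ T f n) := by
  change Measurable fun x => (n : ℝ)⁻¹ * ∑ i ∈ Finset.range n, f (T^[i] x)
  exact (Finset.measurable_sum _ fun i _ => hf.comp (hT.iterate i)).const_mul _

theorem measurable_birkhoffMax (hT : Measurable T) (hf : Measurable f) (n : ℕ) :
    Measurable (birkhoffMax T f n) := by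
  induction n with
  | zero => exact hf
  | succ n ih => exact hf.add (measurable_const.max (ih.comp hT))

theorem integrable_birkhoffMax (hT : MeasurePreserving T μ μ) (hf : Integrable f μ) (n : ℕ) :
    Integrable (birkhoffMax T f n) μ := by
  induction n with
  | zero => exact hf
  | succ n ih =>
    have h : Integrable (fun x => max (birkhoffMax T f n (T x)) 0) μ :=
      (hT.integrable_comp_of_integrable ih).pos_part
    exact hf.add (by simpa only [max_comm] using h)

/-- A form of the maximal ergodic theorem: the integral of `f` over the set where its Birkhoff sums
have infinite supremum is nonnegative. -/
theorem setIntegral_nonneg_of_not_bddAbove_birkhoffMax (hT : MeasurePreserving T μ μ)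
    (hfm : Measurable f) (hf : Integrable f μ) :
    0 ≤ ∫ x in {x | ¬ BddAbove (Set.range fun n => birkhoffMax T f n x)}, f x ∂μ := by
  set A := {x | ¬ BddAbove (Set.range fun n => birkhoffMax T f n x)} with hA
  have hAm : MeasurableSet A :=
    (measurableSet_bddAbove_range (measurable_birkhoffMax hT.measurable hfm)).compl
  have hTA : T ⁻¹' A = A := by
    ext x
    simp only [hA, Set.mem_preimage, Set.mem_ofPred_eq, bddAbove_birkhoffMax_comp_iff]
  have hi := integrable_birkhoffMax hT hf
  have hiT (n : ℕ) : Integrable (fun x => birkhoffMax T f n (T x)) μ :=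
    hT.integrable_comp_of_integrable (hi n)
  -- The integrand is `f` plus the negative part of `birkhoffMax T f n ∘ T`. That part vanishes
  -- eventually on `A`, and is at most `|f ∘ T|` because the maxima dominate `f`.
  have key : Tendsto
      (fun n => ∫ x in A, (birkhoffMax T f (n + 1) x - birkhoffMax T f n (T x)) ∂μ) atTop
      (𝓝 (∫ x in A, f x ∂μ)) := by
    refine tendsto_integral_of_dominated_convergence (fun x => |f x| + |f (T x)|)
      (fun n => ((hi _).sub (hiT n)).aestronglyMeasurable.restrict)
      (hf.abs.add (hT.integrable_comp_of_integrable hf).abs).integrableOn ?_ ?_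
    · refine fun n => ae_of_all _ fun x => ?_
      have h0 : f (T x) ≤ birkhoffMax T f n (T x) := monotone_birkhoffMax (T x) (Nat.zero_le n)
      rw [birkhoffMax_succ, Real.norm_eq_abs, add_sub_assoc]
      refine (abs_add_le _ _).trans (add_le_add le_rfl ?_)
      rcases max_cases 0 (birkhoffMax T f n (T x)) with ⟨h, h'⟩ | ⟨h, h'⟩
      · rw [h, zero_sub, abs_neg, abs_of_nonpos h', abs_of_nonpos (h0.trans h')]
        linarith
      · simp [h]
    · refine (ae_restrict_iff' hAm).2 (ae_of_all _ fun x hx => ?_)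
      have hx' : ¬ BddAbove (Set.range fun n => birkhoffMax T f n (T x)) := by
        rwa [bddAbove_birkhoffMax_comp_iff]
      have ht := (tendsto_atTop_of_monotone (monotone_birkhoffMax (T := T) (f := f) (T x)))
        |>.resolve_right fun ⟨l, hl⟩ => hx' hl.bddAbove_range
      refine tendsto_const_nhds.congr' ?_
      filter_upwards [ht.eventually_ge_atTop 0] with n hn
      rw [birkhoffMax_succ, max_eq_right hn, add_sub_cancel_right]
  refine ge_of_tendsto' key fun n => ?_
  -- Invariance of `μ` and `A` removes `T`; the maxima increase with `n`, so each integral in `key`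
  -- is nonnegative.
  have hc : ∫ x in A, birkhoffMax T f n (T x) ∂μ = ∫ x in A, birkhoffMax T f n x ∂μ := by
    conv_rhs => rw [← hT.map_eq]
    rw [setIntegral_map hAm (measurable_birkhoffMax hT.measurable hfm n).aestronglyMeasurable
      hT.measurable.aemeasurable, hTA]
  rw [integral_sub (hi _).integrableOn (hiT n).integrableOn, hc, sub_nonneg]
  exact integral_mono (hi n).integrableOn (hi _).integrableOn fun x => birkhoffMax_le_succ n x

variable [IsProbabilityMeasure μ]

/-- The sums of `f - c` have infinite supremum on an invariant set. Were it of full measure, the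
maximal theorem would give `∫ (f - c) ≥ 0`; so it is null. -/
theorem _root_.Ergodic.ae_exists_birkhoffSum_le (hT : Ergodic T μ) (hfm : Measurable f)
    (hf : Integrable f μ) {c : ℝ} (hc : ∫ x, f x ∂μ < c) :
    ∀ᵐ x ∂μ, ∃ C : ℝ, ∀ n : ℕ, birkhoffSum T f n x ≤ C + n * c := by
  set g : α → ℝ := fun x => f x - c
  have hgm : Measurable g := hfm.sub_const c
  have hg : Integrable g μ := hf.sub (integrable_const c)
  have hlt : ∫ x, g x ∂μ < 0 := by
    rw [integral_sub hf (integrable_const c)]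
    simpa using hc
  have hmax := setIntegral_nonneg_of_not_bddAbove_birkhoffMax hT.toMeasurePreserving hgm hg
  rcases hT.ae_mem_or_ae_notMem
      (measurableSet_bddAbove_range (measurable_birkhoffMax hT.measurable hgm)).compl
      (by ext x; exact not_congr (bddAbove_birkhoffMax_comp_iff x)) with h | h
  · change ∀ᵐ x ∂μ, x ∈ {x | ¬ BddAbove (Set.range fun n => birkhoffMax T g n x)} at h
    rw [Measure.restrict_eq_self_of_ae_mem h] at hmax
    exact absurd hlt hmax.not_gt
  · filter_upwards [h] with x hx
    obtain ⟨C, hC⟩ := not_not.1 hx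
    -- The `0` covers the empty sum, which `birkhoffMax` leaves out.
    refine ⟨max 0 C, fun n => ?_⟩
    have hsum : birkhoffSum T f n x = birkhoffSum T g n x + n * c := by
      simp [birkhoffSum, g]
    rw [hsum]
    gcongr
    cases n with
    | zero => simp
    | succ n => exact ((birkhoffSum_le_birkhoffMax n x).trans (hC ⟨n, rfl⟩)).trans (le_max_right _ _)

/-- **Birkhoff's pointwise ergodic theorem** for ergodic maps. -/
theorem _root_.Ergodic.ae_tendsto_birkhoffAverage (hT : Ergodic T μ) (hfm : Measurable f)
    (hf : Integrable f μ) :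
    ∀ᵐ x ∂μ, Tendsto (birkhoffAverage ℝ T f · x) atTop (𝓝 (∫ x, f x ∂μ)) := by
  have upper (g : α → ℝ) (hgm : Measurable g) (hg : Integrable g μ) :
      ∀ᵐ x ∂μ, ∀ k : ℕ, ∃ C : ℝ, ∀ n : ℕ,
        birkhoffSum T g n x ≤ C + n * (∫ x, g x ∂μ + 1 / (k + 1)) :=
    ae_all_iff.2 fun k => hT.ae_exists_birkhoffSum_le hgm hg (lt_add_of_pos_right _ (by positivity))
  have limsup_le (s : ℕ → ℝ) (L : ℝ) (h : ∀ k : ℕ, ∃ C : ℝ, ∀ n : ℕ, s n ≤ C + n * (L + 1 / (k + 1)))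
      (u : ℝ) (hu : L < u) : ∀ᶠ n : ℕ in atTop, (n : ℝ)⁻¹ * s n < u := by
    obtain ⟨k, hk⟩ := exists_nat_one_div_lt (sub_pos.2 hu)
    obtain ⟨C, hC⟩ := h k
    have hlim : Tendsto (fun n : ℕ => (n : ℝ)⁻¹ * C + (L + 1 / (k + 1))) atTop
        (𝓝 (0 * C + (L + 1 / (k + 1)))) :=
      (tendsto_inv_atTop_nhds_zero_nat.mul_const C).add_const _
    filter_upwards [hlim.eventually_lt_const (show 0 * C + (L + 1 / (k + 1)) < u by linarith),
      eventually_gt_atTop 0] with n hn hn0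
    refine lt_of_le_of_lt ?_ hn
    have hn0' : (0 : ℝ) < n := Nat.cast_pos.2 hn0
    calc (n : ℝ)⁻¹ * s n ≤ (n : ℝ)⁻¹ * (C + n * (L + 1 / (k + 1))) := by gcongr; exact hC n
      _ = _ := by field_simp
  -- Upper bounds for `-f` are lower bounds for `f`.
  filter_upwards [upper f hfm hf, upper (-f) hfm.neg hf.neg] with x h₁ h₂
  refine tendsto_order.2 ⟨fun u hu => ?_, fun u hu => ?_⟩
  · have := limsup_le _ (∫ x, (-f) x ∂μ) h₂ (-u) (by simpa [integral_neg] using hu)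
    filter_upwards [this] with n hn
    rw [birkhoffSum_neg, mul_neg, neg_lt_neg_iff] at hn
    exact hn
  · exact limsup_le _ _ h₁ u hu

end MeasureTheory

namespace Capacity

variable {Ω : Type*} [MeasurableSpace Ω] {V P : Capacity Ω} {T : Ω → Ω}

theorem nonneg (μ : Capacity Ω) (A : Subtype (MeasurableSet : Set Ω → Prop)) : 0 ≤ μ A :=
  μ.map_empty ▸ μ.mono ∅ A (Set.empty_subset _)

theorem le_one (μ : Capacity Ω) (A : Subtype (MeasurableSet : Set Ω → Prop)) : μ A ≤ 1 :=
  μ.map_univ ▸ μ.mono A ⟨Set.univ, MeasurableSet.univ⟩ (Set.subset_univ _)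

theorem ofProbability_apply (Q : ProbabilityMeasure Ω)
    (A : Subtype (MeasurableSet : Set Ω → Prop)) :
    ofProbability Q A = (Q : Measure Ω).real A := rfl

theorem continuous_apply (A : Subtype (MeasurableSet : Set Ω → Prop)) :
    Continuous fun μ : Capacity Ω => μ A :=
  (_root_.continuous_apply A).comp continuous_induced_dom

/-! ### Continuity of upper probabilities and countable additivity of the core -/

namespace IsUpperProbability

theorem union_le (hV : V.IsUpperProbability) (A B : Subtype (MeasurableSet : Set Ω → Prop)) :
    V (A ∪ B) ≤ V A + V B := by
  obtain ⟨Λ, -, hΛ⟩ := hV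
  obtain ⟨P, hP, hPV⟩ := (hΛ (A ∪ B)).1
  rw [← hPV]
  exact (measureReal_union_le (μ := (P : Measure Ω)) (A : Set Ω) B).trans
    (add_le_add ((hΛ A).2 ⟨P, hP, rfl⟩) ((hΛ B).2 ⟨P, hP, rfl⟩))

/-- An upper probability is continuous from above at the empty set. -/
theorem tendsto_zero (hV : V.IsUpperProbability)
    {A : ℕ → Subtype (MeasurableSet : Set Ω → Prop)}
    (hA : Antitone fun n => (A n : Set Ω)) (hA0 : ⋂ n, (A n : Set Ω) = ∅) :
    Tendsto (fun n => V (A n)) atTop (𝓝 0) := by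
  obtain ⟨Λ, hc, hΛ⟩ := hV
  refine tendsto_order.2 ⟨fun a ha => .of_forall fun n => ha.trans_le (V.nonneg _),
    fun ε hε => ?_⟩
  -- The closed sets `{μ | ε ≤ μ (A n)}` decrease, and no countably additive probability lies in all
  -- of them; by compactness one of them already misses `Λ`.
  have hdir : Directed (· ⊇ ·) fun n : ℕ => {μ : Capacity Ω | ε ≤ μ (A n)} :=
    directed_of_isDirected_le fun m n hmn μ (hμ : ε ≤ μ (A n)) =>
      hμ.trans (μ.mono _ _ (hA hmn))
  obtain ⟨n, hn⟩ := hc.elim_directed_family_closed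
    (fun n => {μ : Capacity Ω | ε ≤ μ (A n)})
    (fun n => isClosed_le continuous_const (continuous_apply (A n))) (by
      rw [Set.eq_empty_iff_forall_notMem]
      rintro _ ⟨⟨P, -, rfl⟩, hP⟩
      have hlim : Tendsto (fun n => (P : Measure Ω).real (A n)) atTop (𝓝 0) := by
        have := tendsto_measure_iInter_atTop (μ := (P : Measure Ω))
          (fun n => (A n).2.nullMeasurableSet) hA ⟨0, measure_ne_top _ _⟩
        rw [hA0, measure_empty] at this
        simpa [Measure.real, Function.comp_def] using
          (ENNReal.tendsto_toReal ENNReal.zero_ne_top).comp this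
      exact hε.not_ge (ge_of_tendsto' hlim fun n => Set.mem_iInter.1 hP n)) hdir
  filter_upwards [eventually_ge_atTop n] with m hm
  by_contra! h
  obtain ⟨P, hP, hPV⟩ := (hΛ (A n)).1
  have : ofProbability P ∈ (∅ : Set (Capacity Ω)) := by
    rw [← hn]
    refine ⟨⟨P, hP, rfl⟩, ?_⟩
    have h' : ε ≤ V (A n) := h.trans (V.mono _ _ (hA hm))
    exact h'.trans hPV.ge
  exact this

/-- The unions of the tails decrease to `∅` by disjointness, so `V`, and with it `P`, tends to `0`
along them. -/
theorem hasSum_of_mem_core (hV : V.IsUpperProbability) (hP : P ∈ V.core)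
    {A : ℕ → Subtype (MeasurableSet : Set Ω → Prop)}
    (hd : Pairwise (Function.onFun Disjoint fun n => (A n : Set Ω))) :
    HasSum (fun n => P (A n)) (P ⟨⋃ n, (A n : Set Ω), .iUnion fun n => (A n).2⟩) := by
  set tail : ℕ → Subtype (MeasurableSet : Set Ω → Prop) := fun n =>
    ⟨⋃ i, (A (i + n) : Set Ω), .iUnion fun i => (A (i + n)).2⟩ with htail
  have hmem (n : ℕ) (x : Ω) : x ∈ (tail n : Set Ω) ↔ ∃ i ≥ n, x ∈ (A i : Set Ω) := by
    simp only [htail, Set.mem_iUnion]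
    exact ⟨fun ⟨i, hi⟩ => ⟨i + n, by omega, hi⟩,
      fun ⟨i, hi, hx⟩ => ⟨i - n, by rwa [Nat.sub_add_cancel hi]⟩⟩
  have hstep (n : ℕ) : P (tail n) = P (A n) + P (tail (n + 1)) := by
    rw [← hP.1]
    · congr 1
      ext x
      simp only [MeasurableSet.coe_union, Set.mem_union, hmem]
      constructor
      · rintro ⟨i, hi, hx⟩
        rcases hi.eq_or_lt with rfl | hi
        exacts [Or.inl hx, Or.inr ⟨i, hi, hx⟩]
      · rintro (hx | ⟨i, hi, hx⟩)
        exacts [⟨n, le_rfl, hx⟩, ⟨i, by omega, hx⟩]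
    · refine Set.disjoint_left.2 fun x hx hx' => ?_
      obtain ⟨i, hi, hxi⟩ := (hmem _ _).1 hx'
      exact Set.disjoint_left.1 (hd (show n ≠ i by omega)) hx hxi
  have hsum (n : ℕ) : ∑ i ∈ Finset.range n, P (A i) = P (tail 0) - P (tail n) := by
    induction n with
    | zero => simp
    | succ n ih => rw [Finset.sum_range_succ, ih, hstep n]; ring
  have hlim : Tendsto (fun n => P (tail n)) atTop (𝓝 0) := by
    refine squeeze_zero (fun n => P.nonneg _) (fun n => hP.2 _) (hV.tendsto_zero ?_ ?_)
    · intro m n hmn x hx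
      obtain ⟨i, hi, hxi⟩ := (hmem _ _).1 hx
      exact (hmem _ _).2 ⟨i, hmn.trans hi, hxi⟩
    · rw [Set.eq_empty_iff_forall_notMem]
      intro x hx
      rw [Set.mem_iInter] at hx
      obtain ⟨i, -, hi⟩ := (hmem _ _).1 (hx 0)
      obtain ⟨j, hj, hxj⟩ := (hmem _ _).1 (hx (i + 1))
      exact Set.disjoint_left.1 (hd (show i ≠ j by omega)) hi hxj
  rw [hasSum_iff_tendsto_nat_of_nonneg fun n => P.nonneg _]
  simp only [hsum]
  simpa [htail] using hlim.const_sub (P (tail 0))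

/-- Every element of the core of an upper probability is countably additive. -/
theorem exists_ofProbability_eq_of_mem_core (hV : V.IsUpperProbability) (hP : P ∈ V.core) :
    ∃ Q : ProbabilityMeasure Ω, ofProbability Q = P := by
  set μ : Measure Ω := Measure.ofMeasurable (fun s hs => ENNReal.ofReal (P ⟨s, hs⟩))
    (by rw [show (⟨∅, MeasurableSet.empty⟩ : Subtype (MeasurableSet : Set Ω → Prop)) = ∅ from rfl,
      P.map_empty, ENNReal.ofReal_zero])
    (fun A hA hd => by
      have h := hV.hasSum_of_mem_core hP (A := fun n => ⟨A n, hA n⟩) hd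
      rw [← ENNReal.ofReal_tsum_of_nonneg (fun n => P.nonneg _) h.summable, h.tsum_eq])
  have happly (A : Subtype (MeasurableSet : Set Ω → Prop)) : μ A = ENNReal.ofReal (P A) :=
    Measure.ofMeasurable_apply _ A.2
  have : IsProbabilityMeasure μ :=
    ⟨by rw [happly ⟨Set.univ, MeasurableSet.univ⟩, P.map_univ, ENNReal.ofReal_one]⟩
  let Q : ProbabilityMeasure Ω := ⟨μ, this⟩
  have heq : (ofProbability Q).toFun = P.toFun := by
    funext A
    change (μ A).toReal = _
    rw [happly, ENNReal.toReal_ofReal (P.nonneg A)]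
  refine ⟨Q, ?_⟩
  generalize ofProbability Q = R at heq
  cases R
  cases P
  congr

end IsUpperProbability

/-! ### Invariant elements of the core -/

theorem IsInvariant.iterate (hT : Measurable T) (hinv : V.IsInvariant hT) (n : ℕ)
    (A : Subtype (MeasurableSet : Set Ω → Prop)) :
    V ⟨T^[n] ⁻¹' A, hT.iterate n A.2⟩ = V A := by
  induction n with
  | zero => rfl
  | succ n ih =>
    rw [← ih]
    exact hinv ⟨T^[n] ⁻¹' A, hT.iterate n A.2⟩

/-- The core of an invariant upper probability contains an invariant additive capacity: a limit
along an ultrafilter of the Cesàro means of the translates of a dominated probability. -/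
theorem IsUpperProbability.exists_mem_core_isInvariant (hT : Measurable T)
    (hV : V.IsUpperProbability) (hinv : V.IsInvariant hT) :
    ∃ P ∈ V.core, P.IsInvariant hT := by
  obtain ⟨Λ, -, hΛ⟩ := hV
  obtain ⟨P, hP, -⟩ := (hΛ ∅).1
  have hPV (A : Subtype (MeasurableSet : Set Ω → Prop)) : (P : Measure Ω).real A ≤ V A :=
    (hΛ A).2 ⟨P, hP, rfl⟩
  set U : Ultrafilter ℕ := hyperfilter ℕ
  have hU : (U : Filter ℕ) ≤ atTop := Nat.hyperfilter_le_atTop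
  set a : ℕ → Set Ω → ℝ := fun n A =>
    (n : ℝ)⁻¹ * ∑ i ∈ Finset.range n, (P : Measure Ω).real (T^[i] ⁻¹' A) with ha
  have ha0 (n : ℕ) (A : Set Ω) : 0 ≤ a n A := by positivity
  have haV (n : ℕ) (A : Subtype (MeasurableSet : Set Ω → Prop)) : a n A ≤ V A := by
    rcases eq_or_ne n 0 with rfl | hn
    · simpa [ha] using V.nonneg A
    have hn' : (0 : ℝ) < n := Nat.cast_pos.2 (Nat.pos_of_ne_zero hn)
    rw [ha]
    dsimp only
    rw [inv_mul_le_iff₀ hn']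
    refine (Finset.sum_le_card_nsmul _ _ (V A) fun i _ => ?_).trans_eq (by simp)
    rw [← hinv.iterate hT i A]
    exact hPV ⟨T^[i] ⁻¹' A, hT.iterate i A.2⟩
  have hlim (A : Subtype (MeasurableSet : Set Ω → Prop)) :
      ∃ l, Tendsto (fun n => a n A) U (𝓝 l) := by
    obtain ⟨l, -, hl⟩ := (isCompact_Icc (a := 0) (b := V A)).ultrafilter_le_nhds
      (U.map fun n => a n A)
      (le_principal_iff.2 (Filter.mem_map.2 (univ_mem' fun n => ⟨ha0 n A, haV n A⟩)))
    exact ⟨l, hl⟩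
  choose m hm using hlim
  refine ⟨⟨m, ?_, ?_, ?_⟩, ⟨?_, ?_⟩, ?_⟩
  · exact tendsto_nhds_unique (hm ∅) (by simp [ha])
  -- The mean with `n = 0` is `0`, so total mass one holds only for `n > 0`.
  · refine tendsto_nhds_unique (hm _) (tendsto_const_nhds.congr' ?_)
    filter_upwards [hU (eventually_gt_atTop 0)] with n hn
    have hn' : (n : ℝ) ≠ 0 := Nat.cast_ne_zero.2 (ne_of_gt hn)
    simp [ha, hn']
  · intro A B hAB
    refine le_of_tendsto_of_tendsto' (hm A) (hm B) fun n => ?_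
    simp only [ha]
    gcongr
    exact measure_ne_top _ _
  · intro A B hAB
    refine tendsto_nhds_unique (hm (A ∪ B)) (((hm A).add (hm B)).congr fun n => ?_)
    simp only [ha, ← mul_add, ← Finset.sum_add_distrib]
    congr 1
    refine Finset.sum_congr rfl fun i _ => ?_
    rw [MeasurableSet.coe_union, Set.preimage_union,
      measureReal_union (hAB.preimage _) (hT.iterate i B.2)]
  · exact fun A => le_of_tendsto' (hm A) fun n => haV n A
  · intro A
    -- By telescoping, this is the difference between the means at `T⁻¹ A` and at `A`.
    have h0 : Tendsto (fun n : ℕ => (n : ℝ)⁻¹ *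
        ((P : Measure Ω).real (T^[n] ⁻¹' A) - (P : Measure Ω).real A)) U (𝓝 0) := by
      refine Tendsto.mono_left ?_ hU
      refine squeeze_zero_norm (fun n => ?_) tendsto_inv_atTop_nhds_zero_nat
      rw [norm_mul, Real.norm_of_nonneg (by positivity)]
      refine mul_le_of_le_one_right (by positivity) ?_
      rw [Real.norm_eq_abs, abs_le]
      have h₁ := measureReal_le_one (μ := (P : Measure Ω)) (s := T^[n] ⁻¹' A)
      have h₂ := measureReal_le_one (μ := (P : Measure Ω)) (s := (A : Set Ω))
      have h₃ := measureReal_nonneg (μ := (P : Measure Ω)) (s := T^[n] ⁻¹' A)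
      have h₄ := measureReal_nonneg (μ := (P : Measure Ω)) (s := (A : Set Ω))
      constructor <;> linarith
    refine tendsto_nhds_unique (hm _) ?_
    have h := (hm A).add h0
    rw [add_zero] at h
    refine h.congr fun n => ?_
    simp only [ha, ← mul_add]
    congr 1
    have hs := Finset.sum_range_succ (fun i => (P : Measure Ω).real (T^[i] ⁻¹' A)) n
    rw [Finset.sum_range_succ'] at hs
    simp only [Function.iterate_zero, Set.preimage_id] at hs
    have hpre (i : ℕ) : T^[i] ⁻¹' (T ⁻¹' (A : Set Ω)) = T^[i + 1] ⁻¹' A := by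
      rw [Function.iterate_succ', Set.preimage_comp]
    simp only [hpre]
    linarith

theorem measurePreserving_of_isInvariant (hT : Measurable T) {Q : ProbabilityMeasure Ω}
    (hQ : (ofProbability Q).IsInvariant hT) :
    MeasurePreserving T (Q : Measure Ω) (Q : Measure Ω) := by
  refine ⟨hT, Measure.ext fun A hA => ?_⟩
  rw [Measure.map_apply hT hA, ← measureReal_eq_measureReal_iff]
  exact hQ ⟨A, hA⟩

/-! ### Time averages and ergodicity of the capacity -/

theorem measure_eq_zero_of_mem_core {Q : ProbabilityMeasure Ω} (hQ : ofProbability Q ∈ V.core)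
    {A : Subtype (MeasurableSet : Set Ω → Prop)} (hA : V A = 0) : (Q : Measure Ω) A = 0 := by
  have h : (Q : Measure Ω).real A ≤ 0 := hA ▸ hQ.2 A
  exact (measureReal_eq_zero_iff).1 (h.antisymm measureReal_nonneg)

/-- Otherwise two `V`-null sets would cover the space, against subadditivity and total mass one. -/
theorem AlmostSurely.exists_and (hV : V.IsUpperProbability) {p q : Ω → Prop}
    (hp : V.AlmostSurely p) (hq : V.AlmostSurely q) : ∃ ω, p ω ∧ q ω := by
  obtain ⟨A, hA, hpA⟩ := hp
  obtain ⟨B, hB, hqB⟩ := hq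
  by_contra! h
  have huniv : (⟨Set.univ, MeasurableSet.univ⟩ : Subtype (MeasurableSet : Set Ω → Prop)) =
      Aᶜ ∪ Bᶜ := by
    ext ω
    simp only [MeasurableSet.coe_union, MeasurableSet.coe_compl, Set.mem_univ, Set.mem_union,
      Set.mem_compl_iff, true_iff]
    by_contra! hω
    exact h ω (hpA ω hω.1) (hqB ω hω.2)
  have := hV.union_le Aᶜ Bᶜ
  rw [← huniv, V.map_univ, hA, hB] at this
  norm_num at this

/-- The time averages of measurable integrable functions converge `V`-almost surely to their
`Q`-means. -/
def TimeAveragesTendsto (V : Capacity Ω) (T : Ω → Ω) (Q : ProbabilityMeasure Ω) : Prop :=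
  ∀ f : Ω → ℝ, Measurable f → Integrable f (Q : Measure Ω) →
    V.AlmostSurely fun ω =>
      Tendsto (birkhoffAverage ℝ T f · ω) atTop (𝓝 (∫ x, f x ∂(Q : Measure Ω)))

theorem timeAveragesTendsto_iff (V : Capacity Ω) (T : Ω → Ω) (Q : ProbabilityMeasure Ω) :
    V.TimeAveragesTendsto T Q ↔
      ∀ f : Ω → ℝ, Measurable f → Integrable f (Q : Measure Ω) →
        V.AlmostSurely fun ω =>
          Tendsto (fun n : ℕ => (1 / (n : ℝ)) * ∑ i ∈ Finset.range n, f (T^[i] ω)) atTop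
            (𝓝 (∫ x, f x ∂(Q : Measure Ω))) := by
  simp only [TimeAveragesTendsto, birkhoffAverage, birkhoffSum, one_div, smul_eq_mul]

/-- The convergence set has `Q`-measure one, so domination forbids it to be `V`-null; ergodicity of
`V` then makes its complement `V`-null. -/
theorem IsErgodic.timeAveragesTendsto (hT : Measurable T) (hV : V.IsErgodic hT)
    {Q : ProbabilityMeasure Ω} (hQ : Ergodic T (Q : Measure Ω))
    (hcore : ofProbability Q ∈ V.core) : V.TimeAveragesTendsto T Q := by
  intro f hfm hf
  set A : Subtype (MeasurableSet : Set Ω → Prop) :=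
    ⟨{ω | Tendsto (birkhoffAverage ℝ T f · ω) atTop (𝓝 (∫ x, f x ∂(Q : Measure Ω)))},
      measurableSet_tendsto _ fun n => measurable_birkhoffAverage hT hfm n⟩
  refine ⟨A, ?_, fun ω hω => hω⟩
  refine (hV.2 A ?_).2.resolve_left fun h => ?_
  · ext ω
    exact tendsto_birkhoffAverage_apply_iff ω _
  · have h₁ := measure_eq_zero_of_mem_core hcore h
    have h₂ : (Q : Measure Ω) (A : Set Ω)ᶜ = 0 := hQ.ae_tendsto_birkhoffAverage hfm hf
    have := measure_add_measure_compl (μ := (Q : Measure Ω)) A.2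
    simp [h₁, h₂] at this

theorem IsErgodic.exists_ergodic_mem_core (hT : Measurable T) (hU : V.IsUpperProbability)
    (hV : V.IsErgodic hT) :
    ∃ Q : ProbabilityMeasure Ω, Ergodic T (Q : Measure Ω) ∧ ofProbability Q ∈ V.core := by
  obtain ⟨P, hP, hPT⟩ := hU.exists_mem_core_isInvariant hT hV.1
  obtain ⟨Q, rfl⟩ := hU.exists_ofProbability_eq_of_mem_core hP
  refine ⟨Q, ⟨measurePreserving_of_isInvariant hT hPT, ⟨fun A hA hTA => ?_⟩⟩, hP⟩
  rw [eventuallyConst_set']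
  rcases (hV.2 ⟨A, hA⟩ hTA).2 with h | h
  · exact Or.inl (ae_eq_empty.2 (measure_eq_zero_of_mem_core hP h))
  · exact Or.inr (ae_eq_univ.2 (measure_eq_zero_of_mem_core hP h))

/-- Indicators are integrable for every probability, so both limits exist at a common point and
agree. Neither ergodicity nor membership in the core enters. -/
theorem TimeAveragesTendsto.unique (hV : V.IsUpperProbability) {Q R : ProbabilityMeasure Ω}
    (hQ : V.TimeAveragesTendsto T Q) (hR : V.TimeAveragesTendsto T R) : Q = R := by
  refine Subtype.ext (Measure.ext fun A hA => ?_)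
  have hm : Measurable (A.indicator (1 : Ω → ℝ)) := measurable_one.indicator hA
  obtain ⟨ω, h₁, h₂⟩ := AlmostSurely.exists_and hV
    (hQ _ hm ((integrable_const 1).indicator hA)) (hR _ hm ((integrable_const 1).indicator hA))
  have h := tendsto_nhds_unique h₁ h₂
  rw [integral_indicator_one hA, integral_indicator_one hA] at h
  exact (measureReal_eq_measureReal_iff (measure_ne_top (Q : Measure Ω) A)
    (measure_ne_top (R : Measure Ω) A)).1 h

theorem TimeAveragesTendsto.isErgodic (hT : Measurable T) (hinv : V.IsInvariant hT)
    {Q : ProbabilityMeasure Ω} (hQ : Ergodic T (Q : Measure Ω))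
    (hcore : ofProbability Q ∈ V.core) (h : V.TimeAveragesTendsto T Q) : V.IsErgodic hT := by
  refine ⟨hinv, fun A hTA => ?_⟩
  obtain ⟨B, hB, hBA⟩ := h ((A : Set Ω).indicator 1) (measurable_one.indicator A.2)
    ((integrable_const 1).indicator A.2)
  have hconst : (A : Set Ω).indicator (1 : Ω → ℝ) ∘ T = (A : Set Ω).indicator 1 := by
    ext ω
    have hω : T ω ∈ (A : Set Ω) ↔ ω ∈ (A : Set Ω) := by rw [← Set.mem_preimage, hTA]
    by_cases h : ω ∈ (A : Set Ω) <;> simp [hω, h]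
  -- The indicator is `T`-invariant, so its averages are constant for `n > 0`.
  have hval (ω : Ω) (hω : ω ∈ (B : Set Ω)) :
      (A : Set Ω).indicator (1 : Ω → ℝ) ω = (Q : Measure Ω).real A := by
    have hlim := hBA ω hω
    rw [integral_indicator_one A.2] at hlim
    refine tendsto_nhds_unique (tendsto_const_nhds.congr' ?_) hlim
    filter_upwards [eventually_gt_atTop 0] with n hn
    rw [birkhoffAverage_of_comp_eq ℝ hconst (Nat.cast_ne_zero.2 hn.ne')]
  rcases hQ.prob_eq_zero_or_one A.2 hTA with h0 | h1
  · have hV0 : V A = 0 := by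
      refine le_antisymm (hB ▸ V.mono A Bᶜ fun ω hω hωB => ?_) (V.nonneg A)
      have := hval ω hωB
      simp [Measure.real, h0, hω] at this
    exact ⟨Or.inl hV0, Or.inl hV0⟩
  · refine ⟨Or.inr (le_antisymm (V.le_one A) ?_), Or.inr ?_⟩
    -- Here domination of `Q` by `V` supplies `V A ≥ 1`; nullity of the complement alone is not
    -- used.
    · have := hcore.2 A
      rwa [ofProbability_apply, Measure.real, h1, ENNReal.toReal_one] at this
    · refine le_antisymm (hB ▸ V.mono Aᶜ Bᶜ fun ω hω hωB => ?_) (V.nonneg _)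
      have hω' : ω ∉ (A : Set Ω) := hω
      have := hval ω hωB
      simp [Measure.real, h1, hω'] at this

end Capacity

theorem theorem3p3 {Ω : Type*} [MeasurableSpace Ω] {T : Ω → Ω} (hT : Measurable T)
    (V : Capacity Ω) (hV : V.IsUpperProbability) (hinv : V.IsInvariant hT) :
    V.IsErgodic hT ↔
      ∃! Q : ProbabilityMeasure Ω,
        (Ergodic T (Q : Measure Ω) ∧ Capacity.ofProbability Q ∈ V.core) ∧
        ∀ f : Ω → ℝ, Measurable f → Integrable f (Q : Measure Ω) →
          V.AlmostSurely fun ω =>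
            Tendsto (fun n : ℕ => (1 / (n : ℝ)) * ∑ i ∈ Finset.range n, f (T^[i] ω)) atTop
              (𝓝 (∫ x, f x ∂(Q : Measure Ω))) := by
  simp only [← Capacity.timeAveragesTendsto_iff]
  constructor
  · intro h
    obtain ⟨Q, hQ, hcore⟩ := h.exists_ergodic_mem_core hT hV
    have hlim := h.timeAveragesTendsto hT hQ hcore
    exact ⟨Q, ⟨⟨hQ, hcore⟩, hlim⟩, fun R hR => hR.2.unique hV hlim⟩
  · rintro ⟨Q, ⟨⟨hQ, hcore⟩, hlim⟩, -⟩
    exact hlim.isErgodic hT hinv hQ hcore
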